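/- Let $I$ be a directed preordered set, and let $(X_i)_{i\in I}$, $(f_{ij}\colon X_j\to X_i)_{i\le j}$ be a projective (inverse) system of nonempty compact Hausdorff spaces and continuous maps, i.e. $f_{ii}=\mathrm{id}$ and $f_{ij}\circ f_{jk}=f_{ik}$ for $i\le j\le k$. Let $\varprojlim X_i=\{(x_i)\in\prod_i X_i : f_{ij}(x_j)=x_i \text{ for all } i\le j\}$ carry the topology induced from the product, and let $X$ be a topological space homotopy equivalent to $\varprojlim X_i$. For a topological space $Z$, let $C(Z)$ denote the ring of continuous functions $Z\to\mathbb{C}$ with pointwise operations. A commutative unital ring $R$ is called projective free if every finitely generated projective $R$-module is free, and Hermite if every finitely generated stably free $R$-module is free, where an $R$-module $M$ is stably free if $M\oplus R^k$ is free for some integer $k\ge 0$. Then: 1. if $C(X_i)$ is projective free for every $i\in I$, then $C(X)$ is projective free; 2. if $C(X_i)$ is Hermite for every $i\in I$, then $C(X)$ is Hermite. -/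

import Mathlib

universe u

/-- A commutative ring is projective free if every finitely generated projective module is free.
(A finitely generated module over `R : Type u` is isomorphic to one living in `Type u`.) -/
def IsProjectiveFree (R : Type u) [CommRing R] : Prop :=
  ∀ (M : Type u) [AddCommGroup M] [Module R M],
    Module.Finite R M → Module.Projective R M → Module.Free R M

/-- A commutative ring is Hermite if every finitely generated stably free module is free. -/
def IsHermite (R : Type u) [CommRing R] : Prop :=
  ∀ (M : Type u) [AddCommGroup M] [Module R M],
    Module.Finite R M → Module.IsStablyFree R M → Module.Free R M

/-- The projective limit of a system of topological spaces and continuous bonding maps: the space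
of compatible families, with the subspace topology of the product topology. -/
abbrev ProjLim {ι : Type*} [Preorder ι] {Y : ι → Type*} [∀ i, TopologicalSpace (Y i)]
    (f : ∀ ⦃i j : ι⦄, i ≤ j → C(Y j, Y i)) : Type _ :=
  {y : ∀ i, Y i // ∀ ⦃i j : ι⦄ (h : i ≤ j), f h (y j) = y i}

/-!
Finitely generated projective modules over `C(X)` are vector bundles, that is, continuous families
of idempotent matrices on `X`, and such a module is free exactly if the family has a global frame.
Two idempotents that are close to each other are conjugate by an invertible matrix depending
continuously on them, so that global frames can be moved along homotopies, for arbitrary `X`.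

On a projective limit of compact Hausdorff spaces, by the Stone–Weierstrass theorem, a continuous
family of idempotents is uniformly close to a family of matrices coming from some `Y i`. The latter
is made idempotent by retracting a neighbourhood of the set of idempotents onto that set. For
stably free modules, given by matrices with `b a = 1`, one approximates the pair `(a, b)` and
replaces `b` by `(b a)⁻¹ b` instead, which keeps the module stably free.
-/

section Algebra

variable {R : Type u} [CommRing R] {n : Type*} [Fintype n]

/-- The range of the matrix `E` is free as a direct summand of `Rⁿ`: the columns of `A` form a
basis of the range of `E`, and the rows of `B` extend the dual basis. Such an `E` is idempotent. -/
def HasFrame (E : Matrix n n R) : Prop :=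
  ∃ (r : ℕ) (A : Matrix n (Fin r) R) (B : Matrix (Fin r) n R), A * B = E ∧ B * A = 1

theorem hasFrame_toMatrix'_iff [DecidableEq n] (p : (n → R) →ₗ[R] n → R) :
    HasFrame (LinearMap.toMatrix' p) ↔
      ∃ (r : ℕ) (α : (Fin r → R) →ₗ[R] n → R) (β : (n → R) →ₗ[R] Fin r → R),
        α ∘ₗ β = p ∧ β ∘ₗ α = LinearMap.id := by
  refine exists_congr fun r => (LinearMap.toMatrix'.toEquiv.exists_congr fun α =>
    LinearMap.toMatrix'.toEquiv.exists_congr fun β => ?_).symm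
  simp only [LinearEquiv.coe_toEquiv, ← LinearMap.toMatrix'_comp, ← LinearMap.toMatrix'_id,
    EmbeddingLike.apply_eq_iff_eq]

theorem exists_linearEquiv_fin_fun (R M : Type*) [CommRing R] [AddCommGroup M] [Module R M]
    [Module.Finite R M] [Module.Free R M] : ∃ r : ℕ, Nonempty (M ≃ₗ[R] (Fin r → R)) :=
  ⟨_, ⟨((Module.Free.chooseBasis R M).reindex (Fintype.equivFin _)).equivFun⟩⟩

theorem free_iff_hasFrame [DecidableEq n] {M : Type*} [AddCommGroup M] [Module R M]
    {f : (n → R) →ₗ[R] M} {g : M →ₗ[R] n → R} (hfg : f ∘ₗ g = LinearMap.id) :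
    Module.Free R M ↔ HasFrame (LinearMap.toMatrix' (g ∘ₗ f)) := by
  rw [hasFrame_toMatrix'_iff]
  constructor
  · intro _
    have : Module.Finite R M := .of_surjective f (LinearMap.surjective_of_comp_eq_id _ _ hfg)
    obtain ⟨r, ⟨e⟩⟩ := exists_linearEquiv_fin_fun R M
    refine ⟨r, g ∘ₗ e.symm.toLinearMap, e.toLinearMap ∘ₗ f, LinearMap.ext fun x => by simp,
      LinearMap.ext fun x => ?_⟩
    simpa using congrArg e (LinearMap.congr_fun hfg (e.symm x))
  · rintro ⟨r, α, β, hαβ, hβα⟩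
    refine .of_equiv (LinearEquiv.ofLinearMap (f ∘ₗ α) (β ∘ₗ g) ?_ ?_)
    · calc (f ∘ₗ α) ∘ₗ β ∘ₗ g = f ∘ₗ (α ∘ₗ β) ∘ₗ g := by simp only [LinearMap.comp_assoc]
        _ = (f ∘ₗ g) ∘ₗ f ∘ₗ g := by rw [hαβ]; simp only [LinearMap.comp_assoc]
        _ = LinearMap.id := by rw [hfg, LinearMap.comp_id]
    · calc (β ∘ₗ g) ∘ₗ f ∘ₗ α = β ∘ₗ (g ∘ₗ f) ∘ₗ α := by simp only [LinearMap.comp_assoc]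
        _ = (β ∘ₗ α) ∘ₗ β ∘ₗ α := by rw [← hαβ]; simp only [LinearMap.comp_assoc]
        _ = LinearMap.id := by rw [hβα, LinearMap.comp_id]

theorem isProjectiveFree_iff_hasFrame : IsProjectiveFree R ↔
    ∀ (n : ℕ) (E : Matrix (Fin n) (Fin n) R), IsIdempotentElem E → HasFrame E := by
  constructor
  · intro h n E hE
    have hproj := LinearMap.IsIdempotentElem.isProj_range _ (hE.map Matrix.toLinAlgEquiv')
    have hsplit : hproj.codRestrict ∘ₗ Submodule.subtype _ = LinearMap.id :=
      LinearMap.ext hproj.codRestrict_apply_cod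
    have hframe := (free_iff_hasFrame hsplit).1 (h _ inferInstance (.of_split _ _ hsplit))
    rw [hproj.subtype_comp_codRestrict] at hframe
    rwa [← LinearMap.toMatrix'_toLin' E]
  · intro h M _ _ _ _
    obtain ⟨n, f, g, -, -, hfg⟩ := Module.Finite.exists_comp_eq_id_of_projective R M
    refine (free_iff_hasFrame hfg).2 (h n _ ?_)
    rw [IsIdempotentElem, ← LinearMap.toMatrix'_comp, LinearMap.comp_assoc,
      ← LinearMap.comp_assoc f, hfg, LinearMap.id_comp]

theorem isProjectiveFree_of_isField (hR : IsField R) : IsProjectiveFree R := by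
  intro M _ _ _ _
  let := hR.toField
  exact Module.Free.of_divisionRing R M

theorem IsProjectiveFree.isHermite (hR : IsProjectiveFree R) : IsHermite R := by
  intro M _ _ _ _
  exact hR M inferInstance inferInstance

theorem isStablyFree_ker {M N : Type*} [AddCommGroup M] [Module R M] [Module.Free R M]
    [AddCommGroup N] [Module R N] [Module.Finite R N] [Module.Free R N]
    {β : M →ₗ[R] N} {α : N →ₗ[R] M} (h : β ∘ₗ α = LinearMap.id) :
    Module.IsStablyFree R (LinearMap.ker β) := by
  obtain ⟨e, -, -⟩ := (LinearMap.exact_subtype_ker_map β).splitSurjectiveEquiv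
    (Submodule.subtype_injective _) ⟨α, h⟩
  have : Module.Free R (LinearMap.ker β × N) := .of_equiv e
  exact .of_free_prod R _ N

theorem isIdempotentElem_one_sub_mul [DecidableEq n] {m : Type*} [Fintype m] [DecidableEq m]
    {A : Matrix n m R} {B : Matrix m n R} (h : B * A = 1) : IsIdempotentElem (1 - A * B) :=
  IsIdempotentElem.one_sub <| by
    rw [IsIdempotentElem, Matrix.mul_assoc, ← Matrix.mul_assoc B, h, Matrix.one_mul]

theorem isHermite_iff_hasFrame : IsHermite R ↔
    ∀ (n k : ℕ) (A : Matrix (Fin n) (Fin k) R) (B : Matrix (Fin k) (Fin n) R), B * A = 1 →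
      HasFrame (1 - A * B) := by
  constructor
  · intro h n k A B hBA
    have hβα : Matrix.toLin' B ∘ₗ Matrix.toLin' A = LinearMap.id := by
      rw [← Matrix.toLin'_mul, hBA, Matrix.toLin'_one]
    let π : (Fin n → R) →ₗ[R] LinearMap.ker (Matrix.toLin' B) :=
      (LinearMap.id - Matrix.toLin' A ∘ₗ Matrix.toLin' B).codRestrict _ fun x => by
        simp [Matrix.mulVec_sub, ← Matrix.mul_assoc, hBA]
    have hπ : π ∘ₗ Submodule.subtype _ = LinearMap.id := by
      ext x
      simp [π]
    have := Module.Finite.of_surjective π fun x => ⟨x, LinearMap.congr_fun hπ x⟩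
    have hframe := (free_iff_hasFrame hπ).1 (h _ inferInstance (isStablyFree_ker hβα))
    rwa [LinearMap.subtype_comp_codRestrict, map_sub, LinearMap.toMatrix'_id,
      LinearMap.toMatrix'_comp, LinearMap.toMatrix'_toLin', LinearMap.toMatrix'_toLin'] at hframe
  · intro h M _ _ _ _
    obtain ⟨N, _, _, _, _, _⟩ := Module.IsStablyFree.exist_free_prod R M
    obtain ⟨n, ⟨e⟩⟩ := exists_linearEquiv_fin_fun R (M × N)
    obtain ⟨k, ⟨c⟩⟩ := exists_linearEquiv_fin_fun R N
    let α := e.toLinearMap ∘ₗ LinearMap.inr R M N ∘ₗ c.symm.toLinearMap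
    let β := c.toLinearMap ∘ₗ LinearMap.snd R M N ∘ₗ e.symm.toLinearMap
    have hβα : β ∘ₗ α = LinearMap.id := by
      ext
      simp [α, β]
    have hfst : (LinearMap.fst R M N ∘ₗ e.symm.toLinearMap) ∘ₗ
        e.toLinearMap ∘ₗ LinearMap.inl R M N = LinearMap.id := by
      ext
      simp
    have hcompl : (e.toLinearMap ∘ₗ LinearMap.inl R M N) ∘ₗ
        LinearMap.fst R M N ∘ₗ e.symm.toLinearMap = LinearMap.id - α ∘ₗ β := by
      refine LinearMap.ext fun x => ?_
      simp [α, β, eq_sub_iff_add_eq, ← map_add]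
    rw [free_iff_hasFrame hfst, hcompl, map_sub, LinearMap.toMatrix'_id, LinearMap.toMatrix'_comp]
    exact h _ _ _ _ (by rw [← LinearMap.toMatrix'_comp, hβα, LinearMap.toMatrix'_id])

end Algebra

section GlobalFrame

variable {X Z : Type*} [TopologicalSpace X] [TopologicalSpace Z] {l m n : Type*} [Fintype n]

/-- A global frame of the vector bundle whose fibre over `x` is the range of the idempotent matrix
`e x`: the columns of `a x` are a basis of that fibre, with dual basis given by the rows of `b x`.
Continuity of `e` is not required separately, since `e = a b`. -/
def HasGlobalFrame {R : Type*} [TopologicalSpace R] [CommRing R] (e : X → Matrix n n R) : Prop :=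
  ∃ (r : ℕ) (a : X → Matrix n (Fin r) R) (b : X → Matrix (Fin r) n R),
    Continuous a ∧ Continuous b ∧ ∀ x, a x * b x = e x ∧ b x * a x = 1

theorem HasGlobalFrame.comp {R : Type*} [TopologicalSpace R] [CommRing R]
    {e : Z → Matrix n n R} (he : HasGlobalFrame e) (g : C(X, Z)) : HasGlobalFrame (e ∘ g) := by
  obtain ⟨r, a, b, ha, hb, hab⟩ := he
  exact ⟨r, a ∘ g, b ∘ g, ha.comp g.continuous, hb.comp g.continuous, fun x => hab (g x)⟩

theorem continuousOn_matrix_inv [DecidableEq n] {𝕜 : Type*} [Field 𝕜] [TopologicalSpace 𝕜]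
    [IsTopologicalDivisionRing 𝕜] :
    ContinuousOn (fun A : Matrix n n 𝕜 => A⁻¹) {A | A.det ≠ 0} := fun A hA =>
  (continuousAt_matrix_inv A
    (Ring.inverse_eq_inv' (G₀ := 𝕜) ▸ continuousAt_inv₀ hA)).continuousWithinAt

theorem HasGlobalFrame.conj [DecidableEq n] {𝕜 : Type*} [Field 𝕜] [TopologicalSpace 𝕜]
    [IsTopologicalDivisionRing 𝕜] {e e' s : X → Matrix n n 𝕜} (he : HasGlobalFrame e)
    (hs : Continuous s) (hdet : ∀ x, (s x).det ≠ 0) (hconj : ∀ x, s x * e x = e' x * s x) :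
    HasGlobalFrame e' := by
  obtain ⟨r, a, b, ha, hb, hab⟩ := he
  have hunit (x : X) : IsUnit (s x).det := (hdet x).isUnit
  have hinv : Continuous fun x => (s x)⁻¹ := continuousOn_matrix_inv.comp_continuous hs hdet
  refine ⟨r, fun x => s x * a x, fun x => b x * (s x)⁻¹, hs.matrix_mul ha, hb.matrix_mul hinv,
    fun x => ⟨?_, ?_⟩⟩
  · calc s x * a x * (b x * (s x)⁻¹)
      _ = s x * (a x * b x) * (s x)⁻¹ := by simp only [Matrix.mul_assoc]
      _ = e' x := by rw [(hab x).1, hconj, Matrix.mul_nonsing_inv_cancel_right _ _ (hunit x)]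
  · rw [Matrix.mul_assoc, Matrix.nonsing_inv_mul_cancel_left _ _ (hunit x), (hab x).2]

variable {R : Type*} [TopologicalSpace R]

/-- Matrices over a ring of continuous functions, as continuous matrix-valued functions. -/
def continuousMatrixEquiv : Matrix l m C(X, R) ≃ C(X, Matrix l m R) where
  toFun M := ⟨fun x => .of fun i j => M i j x, by fun_prop⟩
  invFun F := .of fun i j => ⟨fun x => F x i j, by fun_prop⟩

theorem continuousMatrixEquiv_apply (A : Matrix l m C(X, R)) (x : X) (i : l) (j : m) :
    continuousMatrixEquiv A x i j = A i j x :=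
  rfl

variable [CommRing R]

theorem continuousMatrixEquiv_one [DecidableEq l] (x : X) :
    continuousMatrixEquiv (1 : Matrix l l C(X, R)) x = 1 := by
  ext i j
  by_cases h : i = j <;> simp [continuousMatrixEquiv_apply, Matrix.one_apply, h]

variable [IsTopologicalRing R]

theorem continuousMatrixEquiv_mul (A : Matrix l n C(X, R)) (B : Matrix n m C(X, R)) (x : X) :
    continuousMatrixEquiv (A * B) x = continuousMatrixEquiv A x * continuousMatrixEquiv B x := by
  ext i j
  simp [continuousMatrixEquiv_apply, Matrix.mul_apply]

theorem continuousMatrixEquiv_sub (A B : Matrix l m C(X, R)) (x : X) :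
    continuousMatrixEquiv (A - B) x = continuousMatrixEquiv A x - continuousMatrixEquiv B x :=
  rfl

theorem hasFrame_iff_hasGlobalFrame (E : Matrix n n C(X, R)) :
    HasFrame E ↔ HasGlobalFrame (continuousMatrixEquiv E) := by
  refine exists_congr fun r => ⟨?_, ?_⟩
  · rintro ⟨A, B, hAB, hBA⟩
    refine ⟨_, _, (continuousMatrixEquiv A).continuous, (continuousMatrixEquiv B).continuous,
      fun x => ⟨?_, ?_⟩⟩
    · rw [← hAB, continuousMatrixEquiv_mul]
    · rw [← continuousMatrixEquiv_mul, hBA, continuousMatrixEquiv_one]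
  · rintro ⟨a, b, ha, hb, hab⟩
    refine ⟨continuousMatrixEquiv.symm ⟨a, ha⟩, continuousMatrixEquiv.symm ⟨b, hb⟩,
      continuousMatrixEquiv.injective ?_, continuousMatrixEquiv.injective ?_⟩ <;> ext1 x
    · simpa [continuousMatrixEquiv_mul] using (hab x).1
    · simpa [continuousMatrixEquiv_mul, continuousMatrixEquiv_one] using (hab x).2

theorem isProjectiveFree_iff_hasGlobalFrame : IsProjectiveFree C(X, R) ↔
    ∀ (n : ℕ) (e : C(X, Matrix (Fin n) (Fin n) R)), (∀ x, IsIdempotentElem (e x)) →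
      HasGlobalFrame e := by
  rw [isProjectiveFree_iff_hasFrame]
  refine forall_congr' fun n => continuousMatrixEquiv.forall_congr fun {E} => ?_
  rw [hasFrame_iff_hasGlobalFrame]
  simp only [IsIdempotentElem, ← continuousMatrixEquiv_mul, ← continuousMatrixEquiv.apply_eq_iff_eq,
    ContinuousMap.ext_iff]

theorem isHermite_iff_hasGlobalFrame : IsHermite C(X, R) ↔
    ∀ (n k : ℕ) (a : C(X, Matrix (Fin n) (Fin k) R)) (b : C(X, Matrix (Fin k) (Fin n) R)),
      (∀ x, b x * a x = 1) → HasGlobalFrame fun x => 1 - a x * b x := by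
  rw [isHermite_iff_hasFrame]
  refine forall₂_congr fun n k => continuousMatrixEquiv.forall_congr fun {A} =>
    continuousMatrixEquiv.forall_congr fun {B} => ?_
  have hsub : ⇑(continuousMatrixEquiv (1 - A * B)) =
      fun x => 1 - continuousMatrixEquiv A x * continuousMatrixEquiv B x := by
    ext1 x
    rw [continuousMatrixEquiv_sub, continuousMatrixEquiv_one, continuousMatrixEquiv_mul]
  rw [hasFrame_iff_hasGlobalFrame, hsub, ← continuousMatrixEquiv.apply_eq_iff_eq,
    ContinuousMap.ext_iff]
  simp only [continuousMatrixEquiv_mul, continuousMatrixEquiv_one]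

theorem isField_continuousMap [Unique X] {𝕜 : Type*} [Field 𝕜] [TopologicalSpace 𝕜]
    [IsTopologicalRing 𝕜] : IsField C(X, 𝕜) := by
  refine ⟨⟨0, 1, zero_ne_one⟩, mul_comm, fun {F} hF => ?_⟩
  obtain ⟨x, hx⟩ := DFunLike.ne_iff.1 hF
  refine ⟨.const X (F x)⁻¹, ContinuousMap.ext fun y => ?_⟩
  rw [Subsingleton.elim y x]
  exact mul_inv_cancel₀ hx

end GlobalFrame

section Intertwiner

variable {A : Type*} [Ring A]

/-- An element intertwining the idempotents `q` and `p`, equal to `1` if `p = q`; by continuity it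
is therefore invertible when `p` and `q` are close. -/
def idempotentIntertwiner (p q : A) : A := p * q + (1 - p) * (1 - q)

theorem idempotentIntertwiner_mul {p q : A} (hp : IsIdempotentElem p) (hq : IsIdempotentElem q) :
    idempotentIntertwiner p q * q = p * idempotentIntertwiner p q := by
  calc idempotentIntertwiner p q * q
    _ = p * (q * q) + (1 - p) * ((1 - q) * q) := by
      simp only [idempotentIntertwiner, add_mul, mul_assoc]
    _ = p * p * q + p * (1 - p) * (1 - q) := by
      rw [hq.eq, hq.one_sub_mul_self, hp.eq, hp.mul_one_sub_self, mul_zero, zero_mul]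
    _ = p * idempotentIntertwiner p q := by
      simp only [idempotentIntertwiner, mul_add, mul_assoc]

theorem idempotentIntertwiner_self {p : A} (hp : IsIdempotentElem p) :
    idempotentIntertwiner p p = 1 := by
  rw [idempotentIntertwiner, hp.eq, hp.one_sub.eq, add_sub_cancel]

/-- The product of the intertwiners along a sequence of idempotents, which carries the first of
them to the `k`-th. -/
def idempotentTransport (p : ℕ → A) : ℕ → A
  | 0 => 1
  | k + 1 => idempotentIntertwiner (p (k + 1)) (p k) * idempotentTransport p k

theorem idempotentTransport_mul {p : ℕ → A} (hp : ∀ k, IsIdempotentElem (p k)) (k : ℕ) :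
    idempotentTransport p k * p 0 = p k * idempotentTransport p k := by
  induction k with
  | zero => simp [idempotentTransport]
  | succ k ih =>
    rw [idempotentTransport, mul_assoc, ih, ← mul_assoc, idempotentIntertwiner_mul (hp _) (hp k),
      mul_assoc]

theorem idempotentTransport_succ_of_eq {p : ℕ → A} {k : ℕ} (hp : IsIdempotentElem (p k))
    (h : p (k + 1) = p k) : idempotentTransport p (k + 1) = idempotentTransport p k := by
  rw [idempotentTransport, h, idempotentIntertwiner_self hp, one_mul]

theorem isUnit_idempotentTransport {p : ℕ → A}
    (hp : ∀ k, IsUnit (idempotentIntertwiner (p (k + 1)) (p k))) (k : ℕ) :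
    IsUnit (idempotentTransport p k) := by
  induction k with
  | zero => exact isUnit_one
  | succ k ih => exact (hp k).mul ih

variable {X : Type*} [TopologicalSpace X] [TopologicalSpace A] [IsTopologicalRing A]

theorem continuous_idempotentIntertwiner {p q : X → A} (hp : Continuous p) (hq : Continuous q) :
    Continuous fun x => idempotentIntertwiner (p x) (q x) := by
  unfold idempotentIntertwiner
  fun_prop

theorem continuous_idempotentTransport {p : ℕ → X → A} (hp : ∀ k, Continuous (p k)) (k : ℕ) :
    Continuous fun x => idempotentTransport (fun k => p k x) k := by
  induction k with
  | zero => exact continuous_const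
  | succ k ih => exact (continuous_idempotentIntertwiner (hp _) (hp _)).mul ih

end Intertwiner

section Homotopy

open Filter Topology unitInterval

variable {X Z : Type*} [TopologicalSpace X] [TopologicalSpace Z]

theorem exists_continuous_mesh {K E : Type*} [MetricSpace K] [CompactSpace K] [Nonempty K]
    [NormedAddCommGroup E] {φ : X × K × K → E} (hφ : Continuous φ)
    (hdiag : ∀ x t, φ (x, t, t) ≠ 0) :
    ∃ δ : X → ℝ, Continuous δ ∧ (∀ x, 0 < δ x) ∧ ∀ x s t, dist s t < δ x → φ (x, s, t) ≠ 0 := by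
  let D (x : X) (st : K × K) : ℝ := dist st.1 st.2 + ‖φ (x, st)‖
  have hD : Continuous ↿D :=
    show Continuous fun z : X × K × K => dist z.2.1 z.2.2 + ‖φ z‖ by fun_prop
  have hDpos (x : X) (st : K × K) : 0 < D x st := by
    obtain ⟨s, t⟩ := st
    rcases eq_or_ne s t with rfl | hst
    · exact add_pos_of_nonneg_of_pos dist_nonneg (norm_pos_iff.2 (hdiag x s))
    · exact add_pos_of_pos_of_nonneg (dist_pos.2 hst) (norm_nonneg _)
  refine ⟨fun x => sInf (D x '' Set.univ), isCompact_univ.continuous_sInf hD, fun x => ?_,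
    fun x s t hst h0 => hst.not_ge ?_⟩
  · obtain ⟨st, -, hmin⟩ := isCompact_univ.exists_sInf_image_eq Set.univ_nonempty
      (hD.comp (Continuous.prodMk_right x)).continuousOn
    exact (hDpos x st).trans_eq hmin.symm
  · calc sInf (D x '' Set.univ) ≤ D x (s, t) :=
        csInf_le ⟨0, Set.forall_mem_image.2 fun st _ => (hDpos x st).le⟩ ⟨_, Set.mem_univ _, rfl⟩
      _ = dist s t := by simp [D, h0]

theorem exists_continuous_subdivision {δ : X → ℝ} (hδ : Continuous δ) (hpos : ∀ x, 0 < δ x) :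
    ∃ τ : ℕ → X → I, (∀ k, Continuous (τ k)) ∧ (∀ x, τ 0 x = 0) ∧
      (∀ k x, dist (τ (k + 1) x) (τ k x) < δ x) ∧
      ∀ x, ∃ N, ∀ᶠ y in 𝓝 x, ∀ k ≥ N, τ k y = 1 := by
  refine ⟨fun k x => Set.projIcc 0 1 zero_le_one (k * (δ x / 2)),
    fun k => continuous_projIcc.comp (by fun_prop), fun x => ?_, fun k x => ?_, fun x => ?_⟩
  · simp
  · refine (Set.abs_projIcc_sub_projIcc zero_le_one).trans_lt ?_
    rw [Nat.cast_succ, ← sub_mul, add_sub_cancel_left, one_mul, abs_of_pos (half_pos (hpos x))]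
    exact half_lt_self (hpos x)
  · obtain ⟨N, hN⟩ := exists_nat_gt (1 / (δ x / 2))
    have hNx : 1 < N * (δ x / 2) := (div_lt_iff₀ (half_pos (hpos x))).1 hN
    have hnear : ∀ᶠ y in 𝓝 x, 1 < N * (δ y / 2) :=
      (continuous_const.mul (hδ.div_const 2)).continuousAt.eventually (lt_mem_nhds hNx)
    refine ⟨N, hnear.mono fun y hy k hk => Set.projIcc_of_right_le _ (hy.le.trans ?_)⟩
    have := (half_pos (hpos y)).le
    gcongr

variable {n : Type*} [Fintype n] {𝕜 : Type*} [NormedField 𝕜]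

/- The endpoints are joined by a chain of idempotents, each so close to the next that their
intertwiner is invertible. The number of steps needed varies with `x`, but as `e` is constant
along the tail of the chain, the infinite product is locally finite. -/
theorem exists_conj_of_path [DecidableEq n] {e : X × I → Matrix n n 𝕜} (he : Continuous e)
    (hidem : ∀ z, IsIdempotentElem (e z)) :
    ∃ s : X → Matrix n n 𝕜, Continuous s ∧ (∀ x, (s x).det ≠ 0) ∧
      ∀ x, s x * e (x, 0) = e (x, 1) * s x := by
  obtain ⟨δ, hδ, hpos, hmesh⟩ := exists_continuous_mesh
    (φ := fun z : X × I × I => (idempotentIntertwiner (e (z.1, z.2.1)) (e (z.1, z.2.2))).det)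
    (continuous_idempotentIntertwiner (by fun_prop) (by fun_prop)).matrix_det
    fun x t => by simp [idempotentIntertwiner_self (hidem _)]
  obtain ⟨τ, hτ, hτ0, hτstep, hτ1⟩ := exists_continuous_subdivision hδ hpos
  let T (k : ℕ) (x : X) : Matrix n n 𝕜 := idempotentTransport (fun k => e (x, τ k x)) k
  have hTcont (k : ℕ) : Continuous (T k) :=
    continuous_idempotentTransport (fun k => by have := hτ k; fun_prop) k
  have hTfin : LocallyFinite fun k => {x | T (k + 1) x ≠ T k x} := fun x => by
    obtain ⟨N, hN⟩ := hτ1 x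
    refine ⟨_, hN, (Set.finite_lt_nat N).subset fun k => ?_⟩
    rintro ⟨y, hne, hy⟩
    by_contra hk
    have hk : N ≤ k := not_lt.1 hk
    exact hne (idempotentTransport_succ_of_eq (hidem _) (by rw [hy k hk, hy (k + 1) (by omega)]))
  obtain ⟨s, hs⟩ := hTfin.exists_forall_eventually_atTop_eventuallyEq
  have hlim (x : X) : ∃ k, T k =ᶠ[𝓝 x] s ∧ τ k x = 1 := by
    obtain ⟨N, hN⟩ := hτ1 x
    obtain ⟨k, hk, hkN⟩ := ((hs x).and (eventually_ge_atTop N)).exists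
    exact ⟨k, hk, hN.self_of_nhds k hkN⟩
  refine ⟨s, continuous_iff_continuousAt.2 fun x => ?_, fun x => ?_, fun x => ?_⟩ <;>
    obtain ⟨k, hk, hkx⟩ := hlim x
  · exact (hTcont k).continuousAt.congr hk
  · rw [← hk.eq_of_nhds, ← isUnit_iff_ne_zero, ← Matrix.isUnit_iff_isUnit_det]
    refine isUnit_idempotentTransport (fun k => ?_) k
    exact (Matrix.isUnit_iff_isUnit_det _).2 (hmesh x _ _ (hτstep k x)).isUnit
  · rw [← hk.eq_of_nhds]
    simpa [T, hτ0, hkx] using idempotentTransport_mul (fun k => hidem (x, τ k x)) k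

theorem HasGlobalFrame.of_homotopic {e : Z → Matrix n n 𝕜} (he : Continuous e)
    (hidem : ∀ z, IsIdempotentElem (e z)) {g₀ g₁ : C(X, Z)} (hg : g₀.Homotopic g₁)
    (h : HasGlobalFrame (e ∘ g₀)) : HasGlobalFrame (e ∘ g₁) := by
  classical
  obtain ⟨H⟩ := hg
  obtain ⟨s, hs, hdet, hconj⟩ := exists_conj_of_path (e := fun z : X × I => e (H (z.2, z.1)))
    (by fun_prop) fun _ => hidem _
  exact h.conj hs hdet fun x => by simpa using hconj x

theorem IsProjectiveFree.of_dominated (s : C(X, Z)) (r : C(Z, X))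
    (hrs : (r.comp s).Homotopic (.id X)) (h : IsProjectiveFree C(Z, 𝕜)) :
    IsProjectiveFree C(X, 𝕜) := by
  rw [isProjectiveFree_iff_hasGlobalFrame] at h ⊢
  exact fun n e he => .of_homotopic e.continuous he hrs
    ((h n (e.comp r) fun z => he (r z)).comp s)

theorem IsHermite.of_dominated (s : C(X, Z)) (r : C(Z, X)) (hrs : (r.comp s).Homotopic (.id X))
    (h : IsHermite C(Z, 𝕜)) : IsHermite C(X, 𝕜) := by
  rw [isHermite_iff_hasGlobalFrame] at h ⊢
  intro n k a b hba
  exact .of_homotopic (e := fun x => 1 - a x * b x)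
    (continuous_const.sub (a.continuous.matrix_mul b.continuous))
    (fun x => isIdempotentElem_one_sub_mul (hba x)) hrs
    ((h n k (a.comp r) (b.comp r) fun z => hba (r z)).comp s)

end Homotopy

section Newton

open Filter Topology

variable {A : Type*} [NormedRing A]

/-- The Newton step `x - f x / f' x` for `f x = x² - x`, with the inverse of `f' x = 2x - 1`
replaced by `2x - 1` itself: its square is `1 + 4 f x`. -/
def idempotentNewtonStep (x : A) : A := x - (2 * x - 1) * (x * x - x)

theorem norm_idempotentNewtonStep_mul_self_sub {x : A} (hx : ‖x * x - x‖ ≤ 1 / 16) :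
    ‖idempotentNewtonStep x * idempotentNewtonStep x - idempotentNewtonStep x‖ ≤
      ‖x * x - x‖ / 4 := by
  set u := x * x - x with hu
  have hstep : idempotentNewtonStep x * idempotentNewtonStep x - idempotentNewtonStep x =
      u * u * (u + u + u + u) - (u * u + u * u + u * u) := by
    simp only [idempotentNewtonStep, hu]
    noncomm_ring
  have huu : ‖u * u‖ ≤ ‖u‖ * ‖u‖ := norm_mul_le u u
  have h3 : ‖u * u + u * u + u * u‖ ≤ 3 * (‖u‖ * ‖u‖) := by
    linarith [norm_add₃_le (a := u * u) (b := u * u) (c := u * u)]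
  have h4 : ‖u + u + u + u‖ ≤ 4 * ‖u‖ := by
    linarith [norm_add₄_le (a := u) (b := u) (c := u) (d := u)]
  calc ‖idempotentNewtonStep x * idempotentNewtonStep x - idempotentNewtonStep x‖
    _ ≤ ‖u * u * (u + u + u + u)‖ + ‖u * u + u * u + u * u‖ := hstep ▸ norm_sub_le _ _
    _ ≤ ‖u‖ * ‖u‖ * (4 * ‖u‖) + 3 * (‖u‖ * ‖u‖) :=
      add_le_add ((norm_mul_le _ _).trans (by gcongr)) h3
    _ ≤ ‖u‖ / 4 := by nlinarith [norm_nonneg u, mul_nonneg (norm_nonneg u) (norm_nonneg u)]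

theorem norm_two_mul_idempotentNewtonStep_sub_one (x : A) :
    ‖2 * idempotentNewtonStep x - 1‖ ≤ ‖2 * x - 1‖ * (1 + 2 * ‖x * x - x‖) := by
  set u := x * x - x with hu
  have hstep : 2 * idempotentNewtonStep x - 1 = (2 * x - 1) - (2 * x - 1) * (u + u) := by
    simp only [idempotentNewtonStep, hu]
    noncomm_ring
  calc ‖2 * idempotentNewtonStep x - 1‖
    _ ≤ ‖2 * x - 1‖ + ‖(2 * x - 1) * (u + u)‖ := hstep ▸ norm_sub_le _ _
    _ ≤ ‖2 * x - 1‖ + ‖2 * x - 1‖ * (‖u‖ + ‖u‖) := by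
      gcongr
      exact (norm_mul_le _ _).trans (by gcongr; exact norm_add_le u u)
    _ = ‖2 * x - 1‖ * (1 + 2 * ‖u‖) := by ring

theorem norm_idempotentNewtonStep_iterate_mul_self_sub {x : A} (hx : ‖x * x - x‖ ≤ 1 / 16)
    (k : ℕ) : ‖idempotentNewtonStep^[k] x * idempotentNewtonStep^[k] x -
      idempotentNewtonStep^[k] x‖ ≤ 1 / 16 * (1 / 4) ^ k := by
  induction k with
  | zero => simpa using hx
  | succ k ih =>
    have hk : (1 / 16 : ℝ) * (1 / 4) ^ k ≤ 1 / 16 :=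
      mul_le_of_le_one_right (by norm_num) (pow_le_one₀ (by norm_num) (by norm_num))
    rw [Function.iterate_succ_apply']
    refine (norm_idempotentNewtonStep_mul_self_sub (ih.trans hk)).trans ?_
    rw [pow_succ]
    linarith

theorem norm_two_mul_idempotentNewtonStep_iterate_sub_one {x : A} (hx : ‖x * x - x‖ ≤ 1 / 16)
    (k : ℕ) : ‖2 * idempotentNewtonStep^[k] x - 1‖ ≤ ‖2 * x - 1‖ * 2 ^ k := by
  induction k with
  | zero => simp
  | succ k ih =>
    rw [Function.iterate_succ_apply', pow_succ, ← mul_assoc]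
    refine (norm_two_mul_idempotentNewtonStep_sub_one _).trans ?_
    gcongr
    have := norm_idempotentNewtonStep_iterate_mul_self_sub hx k
    have : (1 / 4 : ℝ) ^ k ≤ 1 := pow_le_one₀ (by norm_num) (by norm_num)
    linarith

theorem norm_idempotentNewtonStep_iterate_succ_sub {x : A} (hx : ‖x * x - x‖ ≤ 1 / 16) (k : ℕ) :
    ‖idempotentNewtonStep^[k + 1] x - idempotentNewtonStep^[k] x‖ ≤ ‖2 * x - 1‖ * (1 / 2) ^ k := by
  have hv := norm_two_mul_idempotentNewtonStep_iterate_sub_one hx k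
  have hu := norm_idempotentNewtonStep_iterate_mul_self_sub hx k
  rw [Function.iterate_succ_apply']
  set y := idempotentNewtonStep^[k] x
  calc ‖idempotentNewtonStep y - y‖
    _ = ‖(2 * y - 1) * (y * y - y)‖ := by rw [idempotentNewtonStep, sub_sub_cancel_left, norm_neg]
    _ ≤ ‖2 * x - 1‖ * 2 ^ k * (1 / 16 * (1 / 4) ^ k) := norm_mul_le_of_le hv hu
    _ = ‖2 * x - 1‖ * (1 / 2) ^ k / 16 := by
      rw [show (1 / 2 : ℝ) = 2 * (1 / 4) by norm_num, mul_pow]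
      ring
    _ ≤ ‖2 * x - 1‖ * (1 / 2) ^ k := div_le_self (by positivity) (by norm_num)

theorem continuousOn_tsum_idempotentNewtonStep [CompleteSpace A] :
    ContinuousOn (fun x : A => ∑' k, (idempotentNewtonStep^[k + 1] x - idempotentNewtonStep^[k] x))
      {x | ‖x * x - x‖ < 1 / 16} := by
  have hiter (k : ℕ) : Continuous (idempotentNewtonStep (A := A))^[k] :=
    Continuous.iterate (by unfold idempotentNewtonStep; fun_prop) k
  intro x hx
  have hnhds : {y : A | ‖y * y - y‖ < 1 / 16 ∧ ‖2 * y - 1‖ < ‖2 * x - 1‖ + 1} ∈ 𝓝 x :=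
    IsOpen.mem_nhds ((isOpen_lt (by fun_prop) continuous_const).and
      (isOpen_lt (by fun_prop) continuous_const)) ⟨hx, lt_add_one _⟩
  refine ((continuousOn_tsum (fun k => ((hiter (k + 1)).sub (hiter k)).continuousOn)
    (summable_geometric_two.mul_left (‖2 * x - 1‖ + 1)) ?_).continuousAt hnhds).continuousWithinAt
  rintro k y ⟨hy, hyx⟩
  refine (norm_idempotentNewtonStep_iterate_succ_sub hy.le k).trans ?_
  gcongr

theorem isIdempotentElem_of_tendsto_idempotentNewtonStep {x y : A} (hx : ‖x * x - x‖ ≤ 1 / 16)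
    (hy : Tendsto (fun k => idempotentNewtonStep^[k] x) atTop (𝓝 y)) : IsIdempotentElem y := by
  refine sub_eq_zero.1 (tendsto_nhds_unique ((hy.mul hy).sub hy) ?_)
  refine squeeze_zero_norm (norm_idempotentNewtonStep_iterate_mul_self_sub hx) ?_
  exact mul_zero (1 / 16 : ℝ) ▸ (tendsto_pow_atTop_nhds_zero_of_lt_one (r := (1 / 4 : ℝ))
    (by norm_num) (by norm_num)).const_mul (1 / 16)

theorem exists_retraction_isIdempotentElem (A : Type*) [NormedRing A] [CompleteSpace A] :
    ∃ (W : Set A) (ρ : A → A), IsOpen W ∧ ContinuousOn ρ W ∧ (∀ x ∈ W, IsIdempotentElem (ρ x)) ∧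
      ∀ x, IsIdempotentElem x → x ∈ W ∧ ρ x = x := by
  refine ⟨{x | ‖x * x - x‖ < 1 / 16},
    fun x => x + ∑' k, (idempotentNewtonStep^[k + 1] x - idempotentNewtonStep^[k] x),
    isOpen_lt (by fun_prop) continuous_const,
    continuousOn_id.add continuousOn_tsum_idempotentNewtonStep, fun x hx => ?_, fun x hx => ?_⟩
  · refine isIdempotentElem_of_tendsto_idempotentNewtonStep (le_of_lt hx) ?_
    have hsum : Summable fun k => idempotentNewtonStep^[k + 1] x - idempotentNewtonStep^[k] x :=
      .of_norm_bounded (summable_geometric_two.mul_left _)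
        (norm_idempotentNewtonStep_iterate_succ_sub (le_of_lt hx))
    simpa only [Finset.sum_range_sub (fun k => idempotentNewtonStep^[k] x), Function.iterate_zero,
      id, add_sub_cancel] using hsum.hasSum.tendsto_sum_nat.const_add x
  · have hfix : Function.IsFixedPt idempotentNewtonStep x := by
      simp [Function.IsFixedPt, idempotentNewtonStep, hx.eq]
    simp [hx.eq, (hfix.iterate _).eq]

end Newton

namespace ProjLim

open Filter Topology

variable {ι : Type*} [Preorder ι] {Y : ι → Type*} [∀ i, TopologicalSpace (Y i)]
  {f : ∀ ⦃i j : ι⦄, i ≤ j → C(Y j, Y i)}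

/-- The canonical projection of a projective limit to its `i`-th term. -/
def proj (f : ∀ ⦃i j : ι⦄, i ≤ j → C(Y j, Y i)) (i : ι) : C(ProjLim f, Y i) :=
  ⟨fun z => z.1 i, (continuous_apply i).comp continuous_subtype_val⟩

theorem comp_proj {i j : ι} (h : i ≤ j) : (f h).comp (proj f j) = proj f i :=
  ContinuousMap.ext fun z => z.2 h

instance compactSpace [∀ i, CompactSpace (Y i)] [∀ i, T2Space (Y i)] :
    CompactSpace (ProjLim f) := by
  have hclosed : IsClosed {y : ∀ i, Y i | ∀ ⦃i j : ι⦄ (h : i ≤ j), f h (y j) = y i} := by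
    simp only [Set.ofPred_forall]
    exact isClosed_iInter fun i => isClosed_iInter fun j => isClosed_iInter fun h =>
      isClosed_eq ((f h).continuous.comp (continuous_apply j)) (continuous_apply i)
  exact hclosed.isClosedEmbedding_subtypeVal.compactSpace

theorem isProjectiveFree_of_isEmpty [IsEmpty ι] {𝕜 : Type*} [Field 𝕜] [TopologicalSpace 𝕜]
    [IsTopologicalRing 𝕜] : IsProjectiveFree C(ProjLim f, 𝕜) := by
  have : Unique (ProjLim f) :=
    { default := ⟨isEmptyElim, isEmptyElim⟩
      uniq := fun _ => Subtype.ext (Subsingleton.elim _ _) }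
  exact isProjectiveFree_of_isField isField_continuousMap

variable [IsDirectedOrder ι] [∀ i, CompactSpace (Y i)] [∀ i, T2Space (Y i)]

theorem exists_forall_mem_of_isOpen [InverseSystem fun ⦃i j : ι⦄ (h : i ≤ j) ↦ ⇑(f h)]
    {i : ι} {V : Set (Y i)} (hV : IsOpen V) (hproj : ∀ z : ProjLim f, proj f i z ∈ V) :
    ∃ (j : ι) (h : i ≤ j), ∀ y, f h y ∈ V := by
  classical
  by_contra! hcon
  have hne (k : ι) : Nonempty (Y k) := by
    obtain ⟨l, hil, hkl⟩ := exists_ge_ge i k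
    exact ⟨f hkl (hcon l hil).choose⟩
  have : Nonempty ι := ⟨i⟩
  choose! y hy using hcon
  let 𝓤 : Ultrafilter ι := .of atTop
  have h𝓤 : (𝓤 : Filter ι) ≤ atTop := Ultrafilter.of_le atTop
  let q (k j : ι) : Y k := if h : k ≤ j then f h (y j) else y k
  have hq {k j : ι} (h : k ≤ j) : q k j = f h (y j) := dif_pos h
  have hconv (k : ι) : ∃ p, Tendsto (q k) 𝓤 (𝓝 p) := ⟨_, (𝓤.map (q k)).le_nhds_lim⟩
  choose p hp using hconv
  have hcompat ⦃k l : ι⦄ (h : k ≤ l) : f h (p l) = p k := by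
    refine tendsto_nhds_unique (((f h).continuous.tendsto _).comp (hp l)) ((hp k).congr' ?_)
    filter_upwards [h𝓤 (eventually_ge_atTop l)] with j hj
    rw [Function.comp_apply, hq hj, hq (h.trans hj)]
    exact (InverseSystem.map_map (f := fun ⦃i j : ι⦄ (h : i ≤ j) ↦ ⇑(f h)) h hj (y j)).symm
  obtain ⟨j, hj, hij⟩ := (((hp i).eventually (hV.mem_nhds (hproj ⟨p, hcompat⟩))).and
    (h𝓤 (eventually_ge_atTop i))).exists
  exact hy j hij (hq hij ▸ hj)

variable {𝕜 : Type*} [RCLike 𝕜]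

theorem dense_iUnion_range_comp_proj [Nonempty ι] :
    Dense (⋃ i, Set.range fun F : C(Y i, 𝕜) => F.comp (proj f i)) := by
  let S (i : ι) : StarSubalgebra 𝕜 C(ProjLim f, 𝕜) :=
    (ContinuousMap.compStarAlgHom' 𝕜 𝕜 (proj f i)).range
  have hS : Directed (· ≤ ·) S := directed_of_isDirected_le fun i j h => by
    rintro _ ⟨F, rfl⟩
    exact ⟨F.comp (f h), congrArg F.comp (comp_proj h)⟩
  have hsep : (⨆ i, S i).SeparatesPoints := fun z w hzw => by
    obtain ⟨i, hi⟩ := Function.ne_iff.1 (Subtype.coe_ne_coe.2 hzw)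
    obtain ⟨F, hF, hne⟩ := separatesPoints_continuous_of_t35Space hi
    have hmem : (RCLike.ofRealCLM.compLeftContinuous ℝ (Y i) ⟨F, hF⟩).comp (proj f i) ∈ ⨆ i, S i :=
      le_iSup S i ⟨_, rfl⟩
    exact ⟨_, ⟨_, hmem, rfl⟩, fun h => hne (RCLike.ofReal_injective h)⟩
  have hdense := ContinuousMap.starSubalgebra_topologicalClosure_eq_top_of_separatesPoints _ hsep
  refine dense_iff_closure_eq.2 ?_
  calc closure (⋃ i, (S i : Set C(ProjLim f, 𝕜))) = closure ↑(⨆ i, S i) := by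
        rw [StarSubalgebra.coe_iSup_of_directed hS]
    _ = Set.univ := congrArg SetLike.coe hdense

theorem dense_iUnion_range_comp_proj_of_finiteDimensional (𝕜 : Type*) [RCLike 𝕜] {V : Type*}
    [AddCommGroup V] [Module 𝕜 V] [FiniteDimensional 𝕜 V] [TopologicalSpace V]
    [IsTopologicalAddGroup V] [ContinuousSMul 𝕜 V] [T2Space V] [Nonempty ι] :
    Dense (⋃ i, Set.range fun F : C(Y i, V) => F.comp (proj f i)) := by
  let b := Module.finBasis 𝕜 V
  let embed (k) : C(𝕜, V) := ⟨fun c => c • b k, by fun_prop⟩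
  let coord (k) : C(V, 𝕜) := ⟨b.coord k, LinearMap.continuous_of_finiteDimensional _⟩
  let Φ (c : Fin (Module.finrank 𝕜 V) → C(ProjLim f, 𝕜)) : C(ProjLim f, V) :=
    ∑ k, (embed k).comp (c k)
  have hΦ : Continuous Φ := continuous_finsetSum _ fun k _ =>
    (ContinuousMap.continuous_postcomp _).comp (continuous_apply k)
  have hsurj : Function.Surjective Φ := fun G =>
    ⟨fun k => (coord k).comp G, ContinuousMap.ext fun z => by simp [Φ, embed, coord, b.sum_repr]⟩
  refine (hsurj.denseRange.dense_image hΦ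
    (dense_pi Set.univ fun _ _ => dense_iUnion_range_comp_proj)).mono ?_
  rintro _ ⟨c, hc, rfl⟩
  simp only [Set.mem_univ_pi, Set.mem_iUnion, Set.mem_range] at hc
  choose i F hF using hc
  obtain ⟨j, hj⟩ := Finite.exists_le i
  refine Set.mem_iUnion.2 ⟨j, ∑ k, (embed k).comp ((F k).comp (f (hj k))), ?_⟩
  ext1 z
  simp [Φ, ← hF, ← comp_proj (hj _)]

theorem exists_comp_proj_mem [Nonempty ι] (𝕜 : Type*) [RCLike 𝕜] {V : Type*}
    [AddCommGroup V] [Module 𝕜 V] [FiniteDimensional 𝕜 V] [TopologicalSpace V]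
    [IsTopologicalAddGroup V] [ContinuousSMul 𝕜 V] [T2Space V] {O : Set (ProjLim f × V)}
    (hO : IsOpen O) (g : C(ProjLim f, V)) (hg : ∀ z, (z, g z) ∈ O) :
    ∃ (i : ι) (F : C(Y i, V)), ∀ z, (z, F (proj f i z)) ∈ O := by
  let graph (G : C(ProjLim f, V)) : C(ProjLim f, ProjLim f × V) := (ContinuousMap.id _).prodMk G
  have hgraph : Continuous graph :=
    ContinuousMap.continuous_of_continuous_uncurry _ (continuous_snd.prodMk continuous_eval)
  have hopen : IsOpen {G | Set.range (graph G) ⊆ O} :=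
    (ContinuousMap.isOpen_setOfPred_range_subset hO).preimage hgraph
  obtain ⟨G, hG, hGO⟩ := (dense_iUnion_range_comp_proj_of_finiteDimensional 𝕜).exists_mem_open
    hopen ⟨g, Set.range_subset_iff.2 hg⟩
  obtain ⟨i, F, rfl⟩ := Set.mem_iUnion.1 hG
  exact ⟨i, F, Set.range_subset_iff.1 hGO⟩

variable [InverseSystem fun ⦃i j : ι⦄ (h : i ≤ j) ↦ ⇑(f h)]

/- A function `F` on some `Y i` approximates `g` so well that `ρ ∘ F` and `ρ ∘ g` are conjugate over
the limit; moving `F` to a larger index makes all its values lie in `W`. -/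
theorem hasGlobalFrame [Nonempty ι] {V : Type*}
    [AddCommGroup V] [Module 𝕜 V] [FiniteDimensional 𝕜 V] [TopologicalSpace V]
    [IsTopologicalAddGroup V] [ContinuousSMul 𝕜 V] [T2Space V] {n : Type*} [Fintype n] {W : Set V}
    (hW : IsOpen W) {ρ : V → Matrix n n 𝕜} (hρ : ContinuousOn ρ W)
    (hidem : ∀ v ∈ W, IsIdempotentElem (ρ v))
    (h : ∀ i (F : C(Y i, V)), (∀ y, F y ∈ W) → HasGlobalFrame (ρ ∘ F))
    (g : C(ProjLim f, V)) (hg : ∀ z, g z ∈ W) : HasGlobalFrame (ρ ∘ g) := by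
  classical
  have hρg : Continuous fun z => ρ (g z) := hρ.comp_continuous g.continuous hg
  have hpair : ContinuousOn (fun p : ProjLim f × V => (ρ (g p.1), ρ p.2)) (Set.univ ×ˢ W) :=
    (hρg.comp continuous_fst).continuousOn.prodMk (hρ.comp continuousOn_snd fun p hp => hp.2)
  have hO : IsOpen {p : ProjLim f × V |
      p ∈ Set.univ ×ˢ W ∧ (idempotentIntertwiner (ρ (g p.1)) (ρ p.2)).det ≠ 0} :=
    ((continuous_idempotentIntertwiner (A := Matrix n n 𝕜)
      continuous_fst continuous_snd).matrix_det.comp_continuousOn hpair).isOpen_inter_preimage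
        (isOpen_univ.prod hW) isOpen_compl_singleton
  obtain ⟨i, F, hF⟩ := exists_comp_proj_mem 𝕜 hO g fun z =>
    ⟨⟨trivial, hg z⟩, by simp [idempotentIntertwiner_self (hidem _ (hg z))]⟩
  have hFW (z) : F (proj f i z) ∈ W := (hF z).1.2
  have hdet (z) : (idempotentIntertwiner (ρ (g z)) (ρ (F (proj f i z)))).det ≠ 0 := (hF z).2
  have hρF : Continuous fun z => ρ (F (proj f i z)) := hρ.comp_continuous (by fun_prop) hFW
  obtain ⟨j, hij, hj⟩ := exists_forall_mem_of_isOpen (hW.preimage F.continuous) hFW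
  have hframe : HasGlobalFrame fun z => ρ (F (proj f i z)) := by
    rw [← comp_proj hij]
    exact (h j (F.comp (f hij)) hj).comp (proj f j)
  exact hframe.conj (continuous_idempotentIntertwiner hρg hρF) hdet fun z =>
    idempotentIntertwiner_mul (hidem _ (hg z)) (hidem _ (hFW z))

open scoped Matrix.Norms.Operator in
theorem isProjectiveFree (h : ∀ i, IsProjectiveFree C(Y i, 𝕜)) :
    IsProjectiveFree C(ProjLim f, 𝕜) := by
  rcases isEmpty_or_nonempty ι
  · exact isProjectiveFree_of_isEmpty
  simp only [isProjectiveFree_iff_hasGlobalFrame] at h ⊢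
  intro n e he
  obtain ⟨W, ρ, hW, hρ, hidem, hρ_self⟩ :=
    exists_retraction_isIdempotentElem (Matrix (Fin n) (Fin n) 𝕜)
  rw [← show ρ ∘ e = e from funext fun z => (hρ_self _ (he z)).2]
  exact hasGlobalFrame (𝕜 := 𝕜) hW hρ hidem
    (fun i F hF => h i n ⟨ρ ∘ F, hρ.comp_continuous F.continuous hF⟩ fun y => hidem _ (hF y))
    e fun z => (hρ_self _ (he z)).1

theorem isHermite (h : ∀ i, IsHermite C(Y i, 𝕜)) : IsHermite C(ProjLim f, 𝕜) := by
  rcases isEmpty_or_nonempty ι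
  · exact isProjectiveFree_of_isEmpty.isHermite
  simp only [isHermite_iff_hasGlobalFrame] at h ⊢
  intro n k a b hba
  let W : Set (Matrix (Fin n) (Fin k) 𝕜 × Matrix (Fin k) (Fin n) 𝕜) := {p | (p.2 * p.1).det ≠ 0}
  let σ (p : Matrix (Fin n) (Fin k) 𝕜 × Matrix (Fin k) (Fin n) 𝕜) := (p.2 * p.1)⁻¹ * p.2
  have hW : IsOpen W := isOpen_ne_fun (by fun_prop) continuous_const
  have hinv : ContinuousOn (fun p => (p.2 * p.1)⁻¹) W :=
    continuousOn_matrix_inv.comp (by fun_prop) fun p hp => hp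
  have hσ : ContinuousOn σ W :=
    (continuous_fst.matrix_mul continuous_snd).comp_continuousOn (hinv.prodMk continuousOn_snd)
  have hσ_mul : ∀ p ∈ W, σ p * p.1 = 1 := fun p hp => by
    rw [Matrix.mul_assoc, Matrix.nonsing_inv_mul _ (isUnit_iff_ne_zero.2 hp)]
  have hσ_ab (z) : σ (a z, b z) = b z := by simp [σ, hba]
  have hframe := hasGlobalFrame (𝕜 := 𝕜) (ρ := fun p => 1 - p.1 * σ p) hW
    (continuousOn_const.sub ((continuous_fst.matrix_mul continuous_snd).comp_continuousOn
      (continuousOn_fst.prodMk hσ)))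
    (fun p hp => isIdempotentElem_one_sub_mul (hσ_mul p hp))
    (fun i F hF => h i n k ⟨fun y => (F y).1, by fun_prop⟩
      ⟨fun y => σ (F y), hσ.comp_continuous F.continuous hF⟩ fun y => hσ_mul _ (hF y))
    (a.prodMk b) fun z => by simp [W, hba]
  simpa only [Function.comp_def, ContinuousMap.prod_eval, hσ_ab] using hframe

end ProjLim

theorem proposition2p7_general {𝕜 : Type*} [RCLike 𝕜] {ι : Type*} [Preorder ι] [IsDirectedOrder ι]
    {Y : ι → Type*} [∀ i, TopologicalSpace (Y i)] [∀ i, CompactSpace (Y i)] [∀ i, T2Space (Y i)]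
    (f : ∀ ⦃i j : ι⦄, i ≤ j → C(Y j, Y i)) [InverseSystem fun ⦃i j : ι⦄ (h : i ≤ j) ↦ ⇑(f h)]
    {X : Type*} [TopologicalSpace X] (s : C(X, ProjLim f)) (r : C(ProjLim f, X))
    (hrs : (r.comp s).Homotopic (.id X)) :
    ((∀ i, IsProjectiveFree C(Y i, 𝕜)) → IsProjectiveFree C(X, 𝕜)) ∧
      ((∀ i, IsHermite C(Y i, 𝕜)) → IsHermite C(X, 𝕜)) :=
  ⟨fun h => .of_dominated s r hrs (ProjLim.isProjectiveFree h),
    fun h => .of_dominated s r hrs (ProjLim.isHermite h)⟩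

theorem proposition2p7 {ι : Type*} [Preorder ι] [IsDirectedOrder ι]
    {Y : ι → Type*} [∀ i, TopologicalSpace (Y i)] [∀ i, CompactSpace (Y i)]
    [∀ i, T2Space (Y i)] [∀ i, Nonempty (Y i)]
    (f : ∀ ⦃i j : ι⦄, i ≤ j → C(Y j, Y i)) [InverseSystem fun ⦃i j : ι⦄ (h : i ≤ j) ↦ ⇑(f h)]
    {X : Type*} [TopologicalSpace X]
    (hX : Nonempty (ContinuousMap.HomotopyEquiv X (ProjLim f))) :
    ((∀ i, IsProjectiveFree C(Y i, ℂ)) → IsProjectiveFree C(X, ℂ)) ∧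
      ((∀ i, IsHermite C(Y i, ℂ)) → IsHermite C(X, ℂ)) := by
  obtain ⟨e⟩ := hX
  exact proposition2p7_general f e.toFun e.invFun e.left_inv
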